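/- All rings are associative with $1\neq 0$ and all subrings contain the identity element of the ring. A maximal subring of a ring $T$ is a subring $S\subsetneq T$ such that no subring lies strictly between $S$ and $T$. A ring is a principal ideal ring if each of its left ideals and each of its right ideals is generated by one element; a principal ideal domain is a (not necessarily commutative) principal ideal ring without zero divisors; a ring is duo if each of its left ideals and each of its right ideals is two-sided. A ring $R$ is prime if, for $a,b\in R$, $aRb=0$ implies $a=0$ or $b=0$. An atom of a domain is a nonzero nonunit that is not a product of two nonunits. Theorem. Let $R$ be a prime principal ideal ring. Then either $R$ has a maximal subring or $R$ is a duo principal ideal domain. Moreover, if $R$ is a principal ideal domain that is not duo, then there is an atom $x\in R$ such that $xRx^{-1}\cap R$ or $x^{-1}Rx\cap R$ (formed in the division ring of fractions of $R$) is a maximal subring of $R$. -/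

import Mathlib

open scoped nonZeroDivisors

/-- A prime ring: a nonzero ring in which `a R b = 0` forces `a = 0` or `b = 0`. -/
structure IsPrimeRing (R : Type*) [Ring R] : Prop where
  nontrivial : Nontrivial R
  eq_zero_or_eq_zero : ∀ a b : R, (∀ r : R, a * r * b = 0) → a = 0 ∨ b = 0

/-- A (two-sided) principal ideal ring: every left ideal is of the form `Ra` and every right ideal
is of the form `aR`. Right ideals of `R` are `Rᵐᵒᵖ`-submodules of `R`. -/
class IsLeftRightPrincipalIdealRing (R : Type*) [Ring R] : Prop where
  left_principal : ∀ I : Ideal R, I.IsPrincipal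
  right_principal : ∀ I : Submodule Rᵐᵒᵖ R, I.IsPrincipal

/-- A duo ring: every left ideal and every right ideal is a two-sided ideal. -/
structure IsDuoRing (R : Type*) [Ring R] : Prop where
  left_duo : ∀ (I : Ideal R) (a r : R), a ∈ I → a * r ∈ I
  right_duo : ∀ (I : Submodule Rᵐᵒᵖ R) (a r : R), a ∈ I → r * a ∈ I

/-- A maximal subring: a proper (unital) subring with no subring strictly between it and the
whole ring. -/
def IsMaximalSubring {R : Type*} [Ring R] (S : Subring R) : Prop :=
  S ≠ ⊤ ∧ ∀ T : Subring R, S ≤ T → T = S ∨ T = ⊤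

/-- A ring has a maximal subring. -/
def HasMaximalSubring (R : Type*) [Ring R] : Prop :=
  ∃ S : Subring R, IsMaximalSubring S

section PrincipalIdealDomain

variable (R : Type*) [Ring R] [IsDomain R] [IsLeftRightPrincipalIdealRing R]

/-- A principal ideal domain is an Ore domain. -/
theorem nonempty_oreSet_of_principal : Nonempty (OreLocalization.OreSet R⁰) :=
  haveI : IsPrincipalIdealRing R := ⟨IsLeftRightPrincipalIdealRing.left_principal⟩
  nonempty_oreSet_of_strongRankCondition

noncomputable instance oreSetOfPrincipal : OreLocalization.OreSet R⁰ :=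
  (nonempty_oreSet_of_principal R).some

/-- The division ring of fractions of a principal ideal domain `R`, that is, the Ore localization
of `R` at its nonzero elements. -/
abbrev FractionDivisionRing : Type _ := OreLocalization R⁰ R

/-- The embedding of a principal ideal domain in its division ring of fractions. -/
noncomputable abbrev toFractionDivisionRing : R →+* FractionDivisionRing R :=
  OreLocalization.numeratorRingHom

variable {R}

/-- The set `xRx⁻¹ ∩ R`, formed in the division ring of fractions of `R`. -/
def conjInter (x : R) : Set R :=
  {r | ∃ s : R, toFractionDivisionRing R r =
    toFractionDivisionRing R x * toFractionDivisionRing R s * (toFractionDivisionRing R x)⁻¹}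

/-- The set `x⁻¹Rx ∩ R`, formed in the division ring of fractions of `R`. -/
def invConjInter (x : R) : Set R :=
  {r | ∃ s : R, toFractionDivisionRing R r =
    (toFractionDivisionRing R x)⁻¹ * toFractionDivisionRing R s * toFractionDivisionRing R x}

end PrincipalIdealDomain

/-! In a left Noetherian prime ring no nonzero element has an essential left annihilator. Hence if R
is not a domain, two nonzero left ideals meet in zero. They enlarge to an essential direct sum A ⊕ C
= Rx; right multiplication by x is injective, and pulling the decomposition back along R ≅ Rx gives
an idempotent e ≠ 0, 1. Primeness makes {r | (1 - e)re = 0} a proper subring, and the Noetherian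
condition provides a maximal subring above it.

In a domain, the idealizer of a maximal right ideal xR is R or a maximal subring; for x ≠ 0 it
equals xRx⁻¹ ∩ R, and x is an atom. The left case is symmetric. If all these idealizers equal R,
splitting off atoms shows that Ra and aR are two-sided for every a, so R is duo. -/

namespace PrincipalIdealRing

/-! ### Essential left ideals, regular generators and idempotents -/

section Essential

variable {R : Type*} [Ring R]

/-- A left ideal that meets every nonzero left ideal nontrivially. -/
def IsEssential (I : Ideal R) : Prop :=
  ∀ y : R, y ≠ 0 → ∃ r : R, r * y ≠ 0 ∧ r * y ∈ I

/-- The left annihilator of an element. -/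
def leftAnnihilator (a : R) : Ideal R :=
  LinearMap.ker (LinearMap.toSpanSingleton R R a)

@[simp]
theorem mem_leftAnnihilator {a r : R} : r ∈ leftAnnihilator a ↔ r * a = 0 := by
  simp [leftAnnihilator]

theorem IsEssential.mono {I J : Ideal R} (hI : IsEssential I) (h : I ≤ J) : IsEssential J :=
  fun y hy => let ⟨r, hr, hrI⟩ := hI y hy; ⟨r, hr, h hrI⟩

/-- The colon left ideal `(I : s)`. -/
def colon (I : Ideal R) (s : R) : Ideal R :=
  Submodule.comap (LinearMap.toSpanSingleton R R s) I

theorem mem_colon {I : Ideal R} {s r : R} : r ∈ colon I s ↔ r * s ∈ I := by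
  simp [colon]

theorem IsEssential.colon {I : Ideal R} (hI : IsEssential I) (s : R) :
    IsEssential (colon I s) := by
  intro y hy
  by_cases h : y * s = 0
  · exact ⟨1, by simpa using hy, by simp [mem_colon, h]⟩
  · obtain ⟨r, hr, hrI⟩ := hI _ h
    refine ⟨r, fun h0 => hr ?_, ?_⟩
    · rw [← mul_assoc, h0, zero_mul]
    · rwa [mem_colon, mul_assoc]

/-- A left Noetherian prime ring is left nonsingular. -/
theorem eq_zero_of_isEssential_leftAnnihilator [IsNoetherianRing R] (hR : IsPrimeRing R) {a : R}
    (ha : IsEssential (leftAnnihilator a)) : a = 0 := by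
  by_contra ha0
  obtain ⟨_, ⟨b, hb, hb0, rfl⟩, hmax⟩ := set_has_maximal_iff_noetherian.mpr
    (inferInstance : IsNoetherian R R)
    {I | ∃ b : R, IsEssential (leftAnnihilator b) ∧ b ≠ 0 ∧ leftAnnihilator b = I}
    ⟨_, a, ha, ha0, rfl⟩
  -- With the annihilator of b maximal, bRb = 0: if brb ≠ 0, then b and brb have the same
  -- annihilator, yet essentiality gives x with xb ≠ 0 and xbrb = 0.
  refine hb0 ((or_self_iff).1 (hR.eq_zero_or_eq_zero b b fun r => ?_))
  by_contra hne
  have hle : leftAnnihilator b ≤ leftAnnihilator (b * r * b) := fun x hx => by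
    rw [mem_leftAnnihilator] at hx ⊢
    rw [mul_assoc, ← mul_assoc, hx, zero_mul]
  obtain ⟨x, hx0, hx⟩ := hb.colon r b hb0
  rw [mem_colon, mem_leftAnnihilator] at hx
  refine hmax _ ⟨b * r * b, hb.mono hle, hne, rfl⟩ (lt_of_le_of_ne hle fun h => hx0 ?_)
  have : x ∈ leftAnnihilator b := by
    rw [h, mem_leftAnnihilator]
    simpa [mul_assoc] using hx
  simpa using this

theorem mem_span_singleton_left {x y : R} : y ∈ Ideal.span {x} ↔ ∃ a, a * x = y :=
  Ideal.mem_span_singleton'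

theorem isEssential_span_mul [IsNoetherianRing R] (hR : IsPrimeRing R) {x z : R}
    (hx : IsEssential (Ideal.span {x})) (hz : IsEssential (Ideal.span {z})) :
    IsEssential (Ideal.span {z * x}) := by
  intro y hy
  obtain ⟨r, hr, hrx⟩ := hx y hy
  obtain ⟨s, hs⟩ := mem_span_singleton_left.1 hrx
  have : ∃ j ∈ colon (Ideal.span {z}) s, j * (s * x) ≠ 0 := by
    by_contra! h
    refine hr (hs ▸ eq_zero_of_isEssential_leftAnnihilator hR ((hz.colon s).mono fun j hj => ?_))
    simpa using h j hj
  obtain ⟨j, hj, hj0⟩ := this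
  obtain ⟨t, ht⟩ := mem_span_singleton_left.1 (mem_colon.1 hj)
  refine ⟨j * r, ?_, ?_⟩
  · rwa [mul_assoc, ← hs]
  · exact mem_span_singleton_left.2 ⟨t, by rw [mul_assoc j, ← hs, ← mul_assoc, ht, mul_assoc]⟩

/-- A generator of an essential left ideal of a left Noetherian prime ring is regular. -/
theorem eq_zero_of_mul_eq_zero_of_isEssential [IsNoetherianRing R] (hR : IsPrimeRing R) {x : R}
    (hx : IsEssential (Ideal.span {x})) {y : R} (hy : y * x = 0) : y = 0 := by
  have hpow : ∀ n : ℕ, IsEssential (Ideal.span {x ^ n}) := by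
    intro n
    induction n with
    | zero => exact fun y hy => ⟨1, by simpa using hy, by simp⟩
    | succ n ih => rw [pow_succ]; exact isEssential_span_mul hR hx ih
  let f : ℕ →o Ideal R :=
    ⟨fun n => leftAnnihilator (x ^ n), monotone_nat_of_le_succ fun n r hr => by
      rw [mem_leftAnnihilator] at hr ⊢
      rw [pow_succ, ← mul_assoc, hr, zero_mul]⟩
  obtain ⟨n, hn⟩ := monotone_stabilizes_iff_noetherian.mpr (inferInstance : IsNoetherian R R) f
  by_contra hy0
  obtain ⟨r, hr, hrx⟩ := hpow (n + 1) y hy0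
  obtain ⟨s, hs⟩ := mem_span_singleton_left.1 hrx
  refine hr ?_
  -- Here ry = sx^(n+1) and yx = 0, so s kills x^(n+2), hence already x^(n+1) by stabilization.
  have h1 : s ∈ f (n + 1 + 1) := by
    change s ∈ leftAnnihilator _
    rw [mem_leftAnnihilator, pow_succ, ← mul_assoc, hs, mul_assoc, hy, mul_zero]
  have h2 : s ∈ f (n + 1) := by
    rw [← hn (n + 1) (by omega), hn (n + 1 + 1) (by omega)]; exact h1
  rw [← hs]
  exact mem_leftAnnihilator.1 h2

/-- Take C maximal among the left ideals containing B and disjoint from A. If Ry missed A + C, then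
C + Ry would still be disjoint from A, forcing y ∈ C. -/
theorem exists_isEssential_sup (A B : Ideal R) (hAB : Disjoint A B) :
    ∃ C : Ideal R, B ≤ C ∧ Disjoint A C ∧ IsEssential (A ⊔ C) := by
  obtain ⟨C, hBC, hC⟩ := zorn_le_nonempty₀ {C : Ideal R | Disjoint A C} (fun c hc hch z hz => by
    refine ⟨sSup c, ?_, fun _ => le_sSup⟩
    exact (hch.directedOn.disjoint_sSup_right).2 hc) B hAB
  refine ⟨C, hBC, hC.prop, fun y hy => ?_⟩
  by_contra! h
  have hle : Disjoint A (C ⊔ Ideal.span {y}) := by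
    rw [Submodule.disjoint_def]
    intro a ha ha'
    obtain ⟨c, hc, w, hw, rfl⟩ := Submodule.mem_sup.1 ha'
    obtain ⟨r, rfl⟩ := mem_span_singleton_left.1 hw
    have : r * y = 0 := by
      by_contra hne
      refine h r hne ?_
      have := (A ⊔ C).sub_mem (Submodule.mem_sup_left ha) (Submodule.mem_sup_right hc)
      simpa using this
    rw [this, add_zero] at ha ⊢
    exact Submodule.disjoint_def.1 hC.prop c ha hc
  have hy' : y ∈ C := hC.le_of_ge hle le_sup_left
    (Submodule.mem_sup_right (Ideal.mem_span_singleton_self y))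
  exact h 1 (by simpa using hy) (by simpa using Submodule.mem_sup_right hy')

/-- A prime ring whose left ideals are principal is a domain or has a nontrivial idempotent. -/
theorem isDomain_or_exists_idempotent [IsPrincipalIdealRing R] (hR : IsPrimeRing R) :
    IsDomain R ∨ ∃ e : R, e * e = e ∧ e ≠ 0 ∧ e ≠ 1 := by
  have := hR.nontrivial
  by_cases hU : ∀ A B : Ideal R, Disjoint A B → A = ⊥ ∨ B = ⊥
  · left
    have : NoZeroDivisors R := ⟨fun {a b} hab => by
      by_contra! h
      refine h.2 (eq_zero_of_isEssential_leftAnnihilator hR fun y hy => ?_)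
      by_contra! hc
      have hd : Disjoint (Ideal.span {y}) (leftAnnihilator b) := by
        rw [Submodule.disjoint_def]
        intro w hw hwb
        obtain ⟨r, rfl⟩ := mem_span_singleton_left.1 hw
        by_contra hne
        exact hc r hne hwb
      rcases hU _ _ hd with h' | h'
      · exact hy (by simpa using h')
      · have : a ∈ leftAnnihilator b := by simpa using hab
        rw [h'] at this
        exact h.1 (by simpa using this)⟩
    exact NoZeroDivisors.to_isDomain R
  · right
    push Not at hU
    obtain ⟨A, B, hAB, hA, hB⟩ := hU
    obtain ⟨C, hBC, hAC, hess⟩ := exists_isEssential_sup A B hAB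
    have hC : C ≠ ⊥ := fun h => hB (le_bot_iff.1 (h ▸ hBC))
    obtain ⟨x, hx⟩ := (IsPrincipalIdealRing.principal (A ⊔ C)).principal
    change A ⊔ C = Ideal.span {x} at hx
    rw [hx] at hess
    have hreg : ∀ y, y * x = 0 → y = 0 :=
      fun y hy => eq_zero_of_mul_eq_zero_of_isEssential hR hess hy
    have hxm : x ∈ A ⊔ C := hx ▸ Ideal.mem_span_singleton_self x
    obtain ⟨a, ha, c, hc, hac⟩ := Submodule.mem_sup.1 hxm
    -- The A-component of x is ex. By injectivity of right multiplication by x, rx ∈ A gives r = re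
    -- and rx ∈ C gives re = 0.
    obtain ⟨e, he⟩ := mem_span_singleton_left.1 (hx ▸ Submodule.mem_sup_left (T := C) ha)
    have hce : c = (1 - e) * x := by rw [sub_mul, he, one_mul, ← hac]; abel
    have hA' : ∀ r, r * x ∈ A → r * (1 - e) = 0 := fun r hr => by
      refine hreg _ (Submodule.disjoint_def.1 hAC _ ?_ ?_)
      · rw [mul_sub, mul_one, sub_mul, mul_assoc, he]
        exact A.sub_mem hr (A.mul_mem_left _ ha)
      · rw [mul_assoc, ← hce]; exact C.mul_mem_left _ hc
    have hC' : ∀ r, r * x ∈ C → r * e = 0 := fun r hr => by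
      refine hreg _ (Submodule.disjoint_def.1 hAC _ ?_ ?_)
      · rw [mul_assoc, he]; exact A.mul_mem_left _ ha
      · have : r * e * x = r * x - r * c := by rw [hce]; noncomm_ring
        rw [this]
        exact C.sub_mem hr (C.mul_mem_left _ hc)
    refine ⟨e, ?_, ?_, ?_⟩
    · have := hA' e (he ▸ ha)
      rw [mul_sub, mul_one, sub_eq_zero] at this
      exact this.symm
    · rintro rfl
      refine hA ((Submodule.eq_bot_iff _).2 fun y hy => ?_)
      obtain ⟨r, rfl⟩ := mem_span_singleton_left.1 (hx ▸ Submodule.mem_sup_left (T := C) hy)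
      have := hA' r hy
      rw [sub_zero, mul_one] at this
      rw [this, zero_mul]
    · rintro rfl
      refine hC ((Submodule.eq_bot_iff _).2 fun y hy => ?_)
      obtain ⟨r, rfl⟩ := mem_span_singleton_left.1 (hx ▸ Submodule.mem_sup_right (S := A) hy)
      have := hC' r hy
      rw [mul_one] at this
      rw [this, zero_mul]

end Essential

/-! ### Maximal subrings from idempotents -/

section Peirce

variable {R : Type*} [Ring R]

/-- The triangular subring `{r | (1 - e) r e = 0}` attached to an idempotent `e`. -/
def triangularSubring {e : R} (he : e * e = e) : Subring R where
  carrier := {r | (1 - e) * r * e = 0}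
  mul_mem' {a b} ha hb := by
    have ha' : a * e = e * a * e := by
      simpa [sub_mul, sub_eq_zero] using ha
    have hb' : b * e = e * b * e := by
      simpa [sub_mul, sub_eq_zero] using hb
    have : (1 - e) * (a * b) * e = (1 - e) * a * e * (b * e) := by
      calc (1 - e) * (a * b) * e = (1 - e) * a * (b * e) := by noncomm_ring
        _ = (1 - e) * a * (e * b * e) := by rw [← hb']
        _ = _ := by noncomm_ring
    change (1 - e) * (a * b) * e = 0
    rw [this, show (1 - e) * a * e = 0 from ha, zero_mul]
  one_mem' := by simp [sub_mul, he]
  add_mem' {a b} ha hb := by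
    change (1 - e) * (a + b) * e = 0
    rw [mul_add, add_mul, show (1 - e) * a * e = 0 from ha, show (1 - e) * b * e = 0 from hb,
      add_zero]
  zero_mem' := by simp
  neg_mem' {a} ha := by
    change (1 - e) * (-a) * e = 0
    rw [mul_neg, neg_mul, show (1 - e) * a * e = 0 from ha, neg_zero]

theorem mem_triangularSubring {e : R} {he : e * e = e} {r : R} :
    r ∈ triangularSubring he ↔ (1 - e) * r * e = 0 := Iff.rfl

/-- A left Noetherian prime ring with a nontrivial idempotent has a maximal subring. -/
theorem hasMaximalSubring_of_idempotent [IsNoetherianRing R] (hR : IsPrimeRing R) {e : R}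
    (he : e * e = e) (he0 : e ≠ 0) (he1 : e ≠ 1) : HasMaximalSubring R := by
  have hf : (1 - e) * (1 - e) = 1 - e := by
    rw [mul_sub, mul_one, sub_mul, one_mul, he, sub_self, sub_zero]
  have hef : e * (1 - e) = 0 := by rw [mul_sub, mul_one, he, sub_self]
  have hne : triangularSubring he ≠ ⊤ := fun h => by
    rcases hR.eq_zero_or_eq_zero (1 - e) e fun r =>
      mem_triangularSubring.1 (h ▸ Subring.mem_top r) with h' | h'
    · exact he1 (sub_eq_zero.1 h').symm
    · exact he0 h'
  have hpeirce : ∀ r, r - (1 - e) * r * e ∈ triangularSubring he := fun r => by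
    rw [mem_triangularSubring, mul_sub, sub_mul, sub_eq_zero]
    calc (1 - e) * r * e = ((1 - e) * (1 - e)) * r * (e * e) := by rw [hf, he]
      _ = _ := by noncomm_ring
  -- A subring T above the triangular one is determined by (1 - e)Te. The left ideal this set
  -- generates loses nothing, since (1 - e) g(T) ⊆ T, so the ascending chain condition applies to
  -- such T.
  let g : Subring R → Ideal R := fun T => Ideal.span ((fun t => (1 - e) * t * e) '' (T : Set R))
  have hg : ∀ T : Subring R, triangularSubring he ≤ T → ∀ w ∈ g T, (1 - e) * w ∈ T := by
    intro T hT w hw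
    have heT : e ∈ T := hT (by rw [mem_triangularSubring, mul_assoc, he, sub_mul, he]; simp)
    have hfT : 1 - e ∈ T := T.sub_mem T.one_mem heT
    -- The extra factor r lets the induction pass through scalar multiples; it is set to 1 at the
    -- end.
    refine Submodule.span_induction ?_ ?_ ?_ ?_ hw (p := fun w _ => ∀ r, (1 - e) * (r * w) ∈ T) 1
      |> fun h => by simpa using h
    · rintro _ ⟨t, ht, rfl⟩ r
      have h1 : (1 - e) * r * (1 - e) ∈ T := hT (by
        rw [mem_triangularSubring, mul_assoc, mul_assoc _ _ e, sub_mul 1 e e, one_mul, he, sub_self]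
        simp)
      have := T.mul_mem (T.mul_mem h1 ht) heT
      convert this using 1
      simp only [mul_assoc]
    · simp
    · intro x y _ _ hx hy r
      rw [mul_add, mul_add]
      exact T.add_mem (hx r) (hy r)
    · intro a x _ hx r
      rw [smul_eq_mul, ← mul_assoc r]
      exact hx _
  obtain ⟨_, ⟨S, hS, hS', rfl⟩, hmax⟩ := set_has_maximal_iff_noetherian.mpr
    (inferInstance : IsNoetherian R R)
    {I | ∃ T : Subring R, triangularSubring he ≤ T ∧ T ≠ ⊤ ∧ g T = I} ⟨_, _, le_rfl, hne, rfl⟩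
  refine ⟨S, hS', fun T hST => or_iff_not_imp_right.2 fun hT => le_antisymm (fun t ht => ?_) hST⟩
  have hle : g S ≤ g T := Ideal.span_mono (Set.image_mono hST)
  have hge : g T = g S := by
    by_contra h
    exact hmax _ ⟨T, hS.trans hST, hT, rfl⟩ (lt_of_le_of_ne hle (Ne.symm h))
  have hmem : (1 - e) * t * e ∈ g S := hge ▸ Ideal.subset_span ⟨t, ht, rfl⟩
  have h2 := hg S hS _ hmem
  rw [← mul_assoc, ← mul_assoc, hf] at h2
  simpa using S.add_mem (hS (hpeirce t)) h2

end Peirce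

/-! ### Idealizers of maximal one-sided ideals -/

section Idealizer

variable {R : Type*} [Ring R]

/-- The idealizer `{r | r x ∈ xR}` of the right ideal `xR`. -/
def rightIdealizer (x : R) : Subring R where
  carrier := {r | ∃ s, r * x = x * s}
  mul_mem' := by
    rintro a b ⟨s, hs⟩ ⟨t, ht⟩
    exact ⟨s * t, by rw [mul_assoc, ht, ← mul_assoc, hs, mul_assoc]⟩
  one_mem' := ⟨1, by simp⟩
  add_mem' := by
    rintro a b ⟨s, hs⟩ ⟨t, ht⟩
    exact ⟨s + t, by rw [add_mul, hs, ht, mul_add]⟩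
  zero_mem' := ⟨0, by simp⟩
  neg_mem' := by
    rintro a ⟨s, hs⟩
    exact ⟨-s, by rw [neg_mul, hs, mul_neg]⟩

/-- The idealizer `{r | x r ∈ Rx}` of the left ideal `Rx`. -/
def leftIdealizer (x : R) : Subring R where
  carrier := {r | ∃ s, x * r = s * x}
  mul_mem' := by
    rintro a b ⟨s, hs⟩ ⟨t, ht⟩
    exact ⟨s * t, by rw [← mul_assoc, hs, mul_assoc, ht, mul_assoc]⟩
  one_mem' := ⟨1, by simp⟩
  add_mem' := by
    rintro a b ⟨s, hs⟩ ⟨t, ht⟩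
    exact ⟨s + t, by rw [mul_add, hs, ht, add_mul]⟩
  zero_mem' := ⟨0, by simp⟩
  neg_mem' := by
    rintro a ⟨s, hs⟩
    exact ⟨-s, by rw [mul_neg, hs, neg_mul]⟩

theorem mem_rightIdealizer {x r : R} : r ∈ rightIdealizer x ↔ ∃ s, r * x = x * s := Iff.rfl

theorem mem_leftIdealizer {x r : R} : r ∈ leftIdealizer x ↔ ∃ s, x * r = s * x := Iff.rfl

theorem mem_span_singleton_right {x y : R} : y ∈ Submodule.span Rᵐᵒᵖ {x} ↔ ∃ a, x * a = y := by
  rw [Submodule.mem_span_singleton]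
  exact ⟨fun ⟨a, ha⟩ => ⟨a.unop, ha⟩, fun ⟨a, ha⟩ => ⟨MulOpposite.op a, ha⟩⟩

/-- The idealizer of a maximal right ideal that is not two-sided is a maximal subring. -/
theorem isMaximalSubring_rightIdealizer {x : R} (hx : IsCoatom (Submodule.span Rᵐᵒᵖ {x}))
    (h : rightIdealizer x ≠ ⊤) : IsMaximalSubring (rightIdealizer x) := by
  refine ⟨h, fun T hT => or_iff_not_imp_left.2 fun hne => ?_⟩
  obtain ⟨t, htT, ht⟩ := SetLike.exists_of_lt (lt_of_le_of_ne hT (Ne.symm hne))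
  have hxT : ∀ a, x * a ∈ T := fun a => hT ⟨a * x, by rw [mul_assoc]⟩
  -- As tx ∉ xR, maximality gives xR + txR = R, and T contains both summands.
  have htop : Submodule.span Rᵐᵒᵖ {x} ⊔ Submodule.span Rᵐᵒᵖ {t * x} = ⊤ := by
    refine hx.2 _ (lt_of_le_of_ne le_sup_left fun heq => ht ?_)
    have : t * x ∈ Submodule.span Rᵐᵒᵖ {x} := by
      rw [heq]; exact Submodule.mem_sup_right (Submodule.mem_span_singleton_self _)
    obtain ⟨s, hs⟩ := mem_span_singleton_right.1 this
    exact ⟨s, hs.symm⟩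
  refine (Subring.eq_top_iff' T).2 fun r => ?_
  obtain ⟨y, hy, z, hz, rfl⟩ := Submodule.mem_sup.1 (htop ▸ Submodule.mem_top (x := r))
  obtain ⟨a, rfl⟩ := mem_span_singleton_right.1 hy
  obtain ⟨b, rfl⟩ := mem_span_singleton_right.1 hz
  exact T.add_mem (hxT a) (mul_assoc t x b ▸ T.mul_mem htT (hxT b))

/-- The idealizer of a maximal left ideal that is not two-sided is a maximal subring. -/
theorem isMaximalSubring_leftIdealizer {x : R} (hx : IsCoatom (Ideal.span {x}))
    (h : leftIdealizer x ≠ ⊤) : IsMaximalSubring (leftIdealizer x) := by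
  refine ⟨h, fun T hT => or_iff_not_imp_left.2 fun hne => ?_⟩
  obtain ⟨t, htT, ht⟩ := SetLike.exists_of_lt (lt_of_le_of_ne hT (Ne.symm hne))
  have hxT : ∀ a, a * x ∈ T := fun a => hT ⟨x * a, by rw [mul_assoc]⟩
  have htop : Ideal.span {x} ⊔ Ideal.span {x * t} = ⊤ := by
    refine hx.2 _ (lt_of_le_of_ne le_sup_left fun heq => ht ?_)
    have : x * t ∈ Ideal.span {x} := by
      rw [heq]; exact Submodule.mem_sup_right (Ideal.mem_span_singleton_self _)
    obtain ⟨s, hs⟩ := mem_span_singleton_left.1 this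
    exact ⟨s, hs.symm⟩
  refine (Subring.eq_top_iff' T).2 fun r => ?_
  obtain ⟨y, hy, z, hz, rfl⟩ := Submodule.mem_sup.1 (htop ▸ Submodule.mem_top (x := r))
  obtain ⟨a, rfl⟩ := mem_span_singleton_left.1 hy
  obtain ⟨b, rfl⟩ := mem_span_singleton_left.1 hz
  exact T.add_mem (hxT a) (mul_assoc b x t ▸ T.mul_mem (hxT b) htT)

theorem isDuoRing_of_idealizer_eq_top (hr : ∀ a : R, rightIdealizer a = ⊤)
    (hl : ∀ a : R, leftIdealizer a = ⊤) : IsDuoRing R where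
  left_duo I a r ha := by
    obtain ⟨s, hs⟩ := mem_leftIdealizer.1 (hl a ▸ Subring.mem_top r)
    rw [hs]
    exact I.mul_mem_left s ha
  right_duo I a r ha := by
    obtain ⟨s, hs⟩ := mem_rightIdealizer.1 (hr a ▸ Subring.mem_top r)
    rw [hs]
    exact I.smul_mem (MulOpposite.op s) ha

theorem isNoetherian_left [IsLeftRightPrincipalIdealRing R] : IsNoetherian R R :=
  ⟨fun I => (IsLeftRightPrincipalIdealRing.left_principal I).fg⟩

theorem isNoetherian_right [IsLeftRightPrincipalIdealRing R] : IsNoetherian Rᵐᵒᵖ R :=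
  ⟨fun I => (IsLeftRightPrincipalIdealRing.right_principal I).fg⟩

end Idealizer

/-! ### Atoms and the duo property in principal ideal domains -/

section Domain

variable {R : Type*} [Ring R] [IsDomain R]

theorem isUnit_of_mul_eq_one_right {a b : R} (h : a * b = 1) : IsUnit a ∧ IsUnit b := by
  have hba : b * a = 1 := by
    have hb : b ≠ 0 := right_ne_zero_of_mul_eq_one h
    refine mul_right_cancel₀ hb ?_
    rw [mul_assoc, h, mul_one, one_mul]
  exact ⟨⟨⟨a, b, h, hba⟩, rfl⟩, ⟨⟨b, a, hba, h⟩, rfl⟩⟩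

theorem span_right_eq_top {u : R} : Submodule.span Rᵐᵒᵖ {u} = ⊤ ↔ IsUnit u := by
  refine ⟨fun h => ?_, ?_⟩
  · obtain ⟨a, ha⟩ := mem_span_singleton_right.1 (h ▸ Submodule.mem_top (x := (1 : R)))
    exact (isUnit_of_mul_eq_one_right ha).1
  · rintro ⟨u, rfl⟩
    refine eq_top_iff.2 fun r _ => mem_span_singleton_right.2 ⟨↑u⁻¹ * r, by simp⟩

theorem span_left_eq_top {u : R} : Ideal.span {u} = ⊤ ↔ IsUnit u := by
  refine ⟨fun h => ?_, ?_⟩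
  · obtain ⟨a, ha⟩ := mem_span_singleton_left.1 (h ▸ Submodule.mem_top (x := (1 : R)))
    exact (isUnit_of_mul_eq_one_right ha).2
  · rintro ⟨u, rfl⟩
    refine eq_top_iff.2 fun r _ => mem_span_singleton_left.2 ⟨r * ↑u⁻¹, by simp⟩

/-- If x = uv with u a nonunit, then uR = xR by maximality, so u = xw = uvw and vw = 1. -/
theorem irreducible_of_isCoatom_right {x : R} (hx0 : x ≠ 0)
    (hx : IsCoatom (Submodule.span Rᵐᵒᵖ {x})) : Irreducible x := by
  refine ⟨fun h => hx.1 (span_right_eq_top.2 h), fun u v huv => or_iff_not_imp_left.2 fun hu => ?_⟩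
  have hle : Submodule.span Rᵐᵒᵖ {x} ≤ Submodule.span Rᵐᵒᵖ {u} := by
    rw [Submodule.span_singleton_le_iff_mem]
    exact mem_span_singleton_right.2 ⟨v, huv.symm⟩
  have heq := (hx.le_iff.1 hle).resolve_left fun h => hu (span_right_eq_top.1 h)
  obtain ⟨w, hw⟩ := mem_span_singleton_right.1 (heq ▸ Submodule.mem_span_singleton_self u)
  have hu0 : u ≠ 0 := by rintro rfl; exact hx0 (by simpa using huv)
  refine (isUnit_of_mul_eq_one_right (b := w) (mul_left_cancel₀ hu0 ?_)).1
  rw [← mul_assoc, ← huv, hw, mul_one]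

theorem irreducible_of_isCoatom_left {x : R} (hx0 : x ≠ 0)
    (hx : IsCoatom (Ideal.span {x})) : Irreducible x := by
  refine ⟨fun h => hx.1 (span_left_eq_top.2 h), fun v u huv => or_iff_not_imp_right.2 fun hu => ?_⟩
  have hle : Ideal.span {x} ≤ Ideal.span {u} := by
    rw [Ideal.span_singleton_le_iff_mem]
    exact mem_span_singleton_left.2 ⟨v, huv.symm⟩
  have heq := (hx.le_iff.1 hle).resolve_left fun h => hu (span_left_eq_top.1 h)
  obtain ⟨w, hw⟩ := mem_span_singleton_left.1 (heq ▸ Ideal.mem_span_singleton_self u)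
  have hu0 : u ≠ 0 := by rintro rfl; exact hx0 (by simpa using huv)
  refine (isUnit_of_mul_eq_one_right (a := w) (mul_right_cancel₀ hu0 ?_)).2
  rw [mul_assoc, ← huv, hw, one_mul]

variable [IsLeftRightPrincipalIdealRing R]

theorem exists_isCoatom_right {a : R} (ha : ¬ IsUnit a) :
    ∃ x b : R, IsCoatom (Submodule.span Rᵐᵒᵖ {x}) ∧ a = x * b := by
  have := isNoetherian_right (R := R)
  obtain h | ⟨M, hM, hle⟩ := eq_top_or_exists_le_coatom (Submodule.span Rᵐᵒᵖ {a})
  · exact absurd (span_right_eq_top.1 h) ha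
  · obtain ⟨x, rfl⟩ := (IsLeftRightPrincipalIdealRing.right_principal M).principal
    obtain ⟨b, hb⟩ := mem_span_singleton_right.1 (hle (Submodule.mem_span_singleton_self a))
    exact ⟨x, b, hM, hb.symm⟩

theorem exists_isCoatom_left {a : R} (ha : ¬ IsUnit a) :
    ∃ x b : R, IsCoatom (Ideal.span {x}) ∧ a = b * x := by
  have := isNoetherian_left (R := R)
  obtain h | ⟨M, hM, hle⟩ := eq_top_or_exists_le_coatom (Ideal.span {a})
  · exact absurd (span_left_eq_top.1 h) ha
  · obtain ⟨x, rfl⟩ := (IsLeftRightPrincipalIdealRing.left_principal M).principal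
    obtain ⟨b, hb⟩ := mem_span_singleton_left.1 (hle (Ideal.mem_span_singleton_self a))
    exact ⟨x, b, hM, hb.symm⟩

/-- Take a counterexample c with Rc maximal and write c = xb with xR a maximal right ideal. As x is
a nonunit, Rb is strictly larger than Rc, so b is no counterexample, and rxb = xsb = xbt. -/
theorem rightIdealizer_eq_top
    (h : ∀ x : R, x ≠ 0 → IsCoatom (Submodule.span Rᵐᵒᵖ {x}) → rightIdealizer x = ⊤) (a : R) :
    rightIdealizer a = ⊤ := by
  by_contra hne
  obtain ⟨_, ⟨c, hc, rfl⟩, hmax⟩ := set_has_maximal_iff_noetherian.mpr (isNoetherian_left (R := R))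
    {I | ∃ a : R, rightIdealizer a ≠ ⊤ ∧ Ideal.span {a} = I} ⟨_, a, hne, rfl⟩
  refine hc ((Subring.eq_top_iff' _).2 fun r => ?_)
  by_cases hc0 : c = 0
  · exact ⟨0, by simp [hc0]⟩
  by_cases hcu : IsUnit c
  · obtain ⟨u, rfl⟩ := hcu
    exact ⟨↑u⁻¹ * r * u, by simp [← mul_assoc]⟩
  obtain ⟨x, b, hx, rfl⟩ := exists_isCoatom_right hcu
  have hx0 : x ≠ 0 := left_ne_zero_of_mul hc0
  have hb0 : b ≠ 0 := right_ne_zero_of_mul hc0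
  have hb : rightIdealizer b = ⊤ := by
    by_contra hb
    refine hmax _ ⟨b, hb, rfl⟩ (lt_of_le_of_ne ?_ fun heq => hx.1 (span_right_eq_top.2 ?_))
    · rw [Ideal.span_singleton_le_iff_mem]
      exact mem_span_singleton_left.2 ⟨x, rfl⟩
    · obtain ⟨y, hy⟩ := mem_span_singleton_left.1 (heq ▸ Ideal.mem_span_singleton_self b)
      refine (isUnit_of_mul_eq_one_right (a := y) (mul_right_cancel₀ hb0 ?_)).2
      rw [mul_assoc, hy, one_mul]
  obtain ⟨s, hs⟩ := mem_rightIdealizer.1 (h x hx0 hx ▸ Subring.mem_top r)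
  obtain ⟨t, ht⟩ := mem_rightIdealizer.1 (hb ▸ Subring.mem_top s)
  exact ⟨t, by rw [← mul_assoc, hs, mul_assoc, ht, mul_assoc]⟩

theorem leftIdealizer_eq_top
    (h : ∀ x : R, x ≠ 0 → IsCoatom (Ideal.span {x}) → leftIdealizer x = ⊤) (a : R) :
    leftIdealizer a = ⊤ := by
  by_contra hne
  obtain ⟨_, ⟨c, hc, rfl⟩, hmax⟩ := set_has_maximal_iff_noetherian.mpr
    (isNoetherian_right (R := R))
    {I | ∃ a : R, leftIdealizer a ≠ ⊤ ∧ Submodule.span Rᵐᵒᵖ {a} = I} ⟨_, a, hne, rfl⟩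
  refine hc ((Subring.eq_top_iff' _).2 fun r => ?_)
  by_cases hc0 : c = 0
  · exact ⟨0, by simp [hc0]⟩
  by_cases hcu : IsUnit c
  · obtain ⟨u, rfl⟩ := hcu
    exact ⟨u * r * ↑u⁻¹, by simp [mul_assoc]⟩
  obtain ⟨x, b, hx, rfl⟩ := exists_isCoatom_left hcu
  have hx0 : x ≠ 0 := right_ne_zero_of_mul hc0
  have hb0 : b ≠ 0 := left_ne_zero_of_mul hc0
  have hb : leftIdealizer b = ⊤ := by
    by_contra hb
    refine hmax _ ⟨b, hb, rfl⟩ (lt_of_le_of_ne ?_ fun heq => hx.1 (span_left_eq_top.2 ?_))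
    · rw [Submodule.span_singleton_le_iff_mem]
      exact mem_span_singleton_right.2 ⟨x, rfl⟩
    · obtain ⟨y, hy⟩ := mem_span_singleton_right.1 (heq ▸ Submodule.mem_span_singleton_self b)
      refine (isUnit_of_mul_eq_one_right (b := y) (mul_left_cancel₀ hb0 ?_)).1
      rw [← mul_assoc, hy, mul_one]
  obtain ⟨s, hs⟩ := mem_leftIdealizer.1 (h x hx0 hx ▸ Subring.mem_top r)
  obtain ⟨t, ht⟩ := mem_leftIdealizer.1 (hb ▸ Subring.mem_top s)
  exact ⟨t, by rw [mul_assoc, hs, ← mul_assoc, ht, mul_assoc]⟩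

theorem toFractionDivisionRing_injective : Function.Injective (toFractionDivisionRing R) :=
  OreLocalization.numeratorHom_inj inf_le_left

/-- In the division ring, rx = xs is equivalent to r = xsx⁻¹. -/
theorem coe_rightIdealizer {x : R} (hx : x ≠ 0) : (rightIdealizer x : Set R) = conjInter x := by
  have hx' : toFractionDivisionRing R x ≠ 0 :=
    (map_ne_zero_iff _ toFractionDivisionRing_injective).2 hx
  ext r
  refine exists_congr fun s => ?_
  rw [eq_mul_inv_iff_mul_eq₀ hx', ← map_mul, ← map_mul, toFractionDivisionRing_injective.eq_iff]

theorem coe_leftIdealizer {x : R} (hx : x ≠ 0) : (leftIdealizer x : Set R) = invConjInter x := by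
  have hx' : toFractionDivisionRing R x ≠ 0 :=
    (map_ne_zero_iff _ toFractionDivisionRing_injective).2 hx
  ext r
  refine exists_congr fun s => ?_
  rw [mul_assoc, eq_inv_mul_iff_mul_eq₀ hx', ← map_mul, ← map_mul,
    toFractionDivisionRing_injective.eq_iff]

/-- In a principal ideal domain that is not duo, the idealizer of some maximal one-sided ideal is
a maximal subring. -/
theorem exists_irreducible_isMaximalSubring (hR : ¬ IsDuoRing R) :
    ∃ x : R, Irreducible x ∧ ∃ S : Subring R, IsMaximalSubring S ∧
      ((S : Set R) = conjInter x ∨ (S : Set R) = invConjInter x) := by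
  by_contra! h
  refine hR (isDuoRing_of_idealizer_eq_top (rightIdealizer_eq_top fun x hx0 hx => ?_)
    (leftIdealizer_eq_top fun x hx0 hx => ?_))
  · by_contra hne
    exact (h x (irreducible_of_isCoatom_right hx0 hx) _
      (isMaximalSubring_rightIdealizer hx hne)).1 (coe_rightIdealizer hx0)
  · by_contra hne
    exact (h x (irreducible_of_isCoatom_left hx0 hx) _
      (isMaximalSubring_leftIdealizer hx hne)).2 (coe_leftIdealizer hx0)

end Domain

end PrincipalIdealRing

open PrincipalIdealRing in
theorem theorem2p9 (R : Type*) [Ring R] [IsLeftRightPrincipalIdealRing R] :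
    (IsPrimeRing R →
      HasMaximalSubring R ∨ (IsDomain R ∧ IsLeftRightPrincipalIdealRing R ∧ IsDuoRing R)) ∧
    (∀ [IsDomain R], ¬ IsDuoRing R →
      ∃ x : R, Irreducible x ∧ ∃ S : Subring R, IsMaximalSubring S ∧
        ((S : Set R) = conjInter x ∨ (S : Set R) = invConjInter x)) := by
  refine ⟨fun hR => ?_, fun h => exists_irreducible_isMaximalSubring h⟩
  have : IsPrincipalIdealRing R := ⟨IsLeftRightPrincipalIdealRing.left_principal⟩
  obtain hD | ⟨e, he, he0, he1⟩ := isDomain_or_exists_idempotent hR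
  · by_cases hduo : IsDuoRing R
    · exact Or.inr ⟨hD, inferInstance, hduo⟩
    · obtain ⟨-, -, S, hS, -⟩ := exists_irreducible_isMaximalSubring hduo
      exact Or.inl ⟨S, hS⟩
  · exact Or.inl (hasMaximalSubring_of_idempotent hR he he0 he1)
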